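/- Throughout, rings are unital. A ring is clean if each of its elements is the sum of an idempotent and a unit. An element $r$ of a (not necessarily commutative) ring $S$ is strongly $\pi$-regular if both chains $rS\supseteq r^2S\supseteq r^3S\supseteq\cdots$ and $Sr\supseteq Sr^2\supseteq Sr^3\supseteq\cdots$ of one-sided ideals terminate. For a commutative ring $S$, a polynomial $f\in S[t]$ has an SP-factorization if $f=h_0p_0$ for some $h_0,p_0\in S[t]$ such that $h_0(0)$ is a unit of $S$ and every coefficient of $p_0-t^{\deg p_0}$ is nilpotent (with the convention $\deg 0=0$). For a commutative ring $R$, a polynomial $h\in R[t]$ has a gSP-factorization if there are finitely many pairwise orthogonal idempotents $e_1,\dots,e_k\in R$ with $e_1+\cdots+e_k=1$ such that, for each $i$, the image $he_i$ of $h$ in $(e_iR)[t]$ has an SP-factorization over the ring $e_iR$ (with identity element $e_i$). Proposition. Let $R$ be a commutative clean ring and let $h\in R[t]$ be a monic polynomial of degree $n$. For an $n\times n$ matrix $A$ over $R$, let $\chi(A)$ denote its characteristic polynomial. Then the following are equivalent: (1) Every $A\in \mathrm{M}_n(R)$ with $\chi(A)=h$ is strongly $\pi$-regular. (2) There exists $A\in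 \mathrm{M}_n(R)$ with $\chi(A)=h$ which is strongly $\pi$-regular. (3) The polynomial $h$ has a gSP-factorization. -/

import Mathlib

open Polynomial

namespace CleanMatrix

/-- An element of a ring is clean if it is the sum of an idempotent and a unit. -/
def IsClean {S : Type*} [Ring S] (r : S) : Prop :=
  ∃ e u : S, IsIdempotentElem e ∧ IsUnit u ∧ r = e + u

/-- A ring is clean if each of its elements is clean. -/
def IsCleanRing (S : Type*) [Ring S] : Prop :=
  ∀ r : S, IsClean r

/-- An element `r` of a (possibly noncommutative) ring `S` is strongly π-regular if both chains of
principal one-sided ideals `rS ⊇ r²S ⊇ r³S ⊇ ⋯` and `Sr ⊇ Sr² ⊇ Sr³ ⊇ ⋯` terminate. -/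
def IsStronglyPiRegular {S : Type*} [Ring S] (r : S) : Prop :=
  (∃ k : ℕ, 1 ≤ k ∧ ∀ m : ℕ, k ≤ m →
    Set.range (fun x : S => r ^ m * x) = Set.range (fun x : S => r ^ k * x)) ∧
  (∃ k : ℕ, 1 ≤ k ∧ ∀ m : ℕ, k ≤ m →
    Set.range (fun x : S => x * r ^ m) = Set.range (fun x : S => x * r ^ k))

/-- `h` has an SP-factorization: `h = h₀ p₀` with `h₀(0)` a unit and
all coefficients of `p₀ - t ^ (deg p₀)` in the nil radical. -/
def HasSPFactorization {S : Type*} [CommRing S] (h : S[X]) : Prop :=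
  ∃ h₀ p₀ : S[X], h = h₀ * p₀ ∧ IsUnit (h₀.eval 0) ∧
    ∀ k : ℕ, (p₀ - X ^ p₀.natDegree).coeff k ∈ nilradical S

/-- For an idempotent `e` of a commutative ring `R`, the ring homomorphism `r ↦ r e = e r e` onto
the ring `eR`, whose identity element is `e`. -/
def cornerMap {R : Type*} [CommRing R] {e : R} (he : IsIdempotentElem e) : R →+* he.Corner where
  toFun r := ⟨e * r * e, r, rfl⟩
  map_one' := Subtype.ext (by
    change e * 1 * e = e
    rw [mul_one, he.eq])
  map_mul' r s := Subtype.ext (by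
    change e * (r * s) * e = (e * r * e) * (e * s * e)
    have h := he.eq
    linear_combination (-(r * s * (e * e + e))) * h)
  map_zero' := Subtype.ext (by
    change e * 0 * e = 0
    ring)
  map_add' r s := Subtype.ext (by
    change e * (r + s) * e = e * r * e + e * s * e
    ring)

/-- `h` has a gSP-factorization: there is a complete orthogonal set of idempotents `e₁, …, e_k` of
`R` such that, for each `i`, the polynomial `h eᵢ` has an SP-factorization over the ring `eᵢR`. -/
def HasGSPFactorization {R : Type*} [CommRing R] (h : R[X]) : Prop :=
  ∃ (k : ℕ) (e : Fin k → R) (he : CompleteOrthogonalIdempotents e),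
    ∀ i : Fin k, HasSPFactorization (h.map (cornerMap (he.idem i)))

end CleanMatrix

/-! Both directions pass through polynomial identities valid over any commutative ring. From (3) to
(1): an SP-factorization makes `h` divide some `X ^ M * (1 - X * q)`, because `p₀` divides a power
of `X` and `h₀` is a unit times `1 - X * q`. Idempotents glue these divisibilities, and
Cayley–Hamilton gives `A ^ (M + 1) = A ^ (M + 2) * q(A)`. From (1) to (2): multiplication by the
root in `R[X]/(h)` has characteristic polynomial `h`. From (2) to (3): the Fitting idempotent `f` of
`A` splits `X - A` into a part invertible at `X = 0`, with determinant `h₀`, and a nilpotent part,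
with determinant `p`. The coefficients of `det (f + X (1 - f))` are orthogonal idempotents with sum
1; on the `i`-th corner `1 - f` has rank `i`, so there `p` is `X ^ i` up to nilpotents. -/

namespace CleanMatrix

/-! ### Strong π-regularity and Fitting idempotents -/

section PiRegular

variable {S : Type*} [Ring S]

/-- An element `r` with `r ^ M = r ^ (M + 1) * b` for some `b` commuting with `r` is strongly
π-regular. -/
theorem IsStronglyPiRegular.of_pow_eq {r b : S} {M : ℕ} (hM : 1 ≤ M) (hb : Commute r b)
    (h : r ^ M = r ^ (M + 1) * b) : IsStronglyPiRegular r := by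
  have key : ∀ j : ℕ, r ^ M = r ^ (M + j) * b ^ j := by
    intro j
    induction j with
    | zero => simp
    | succ j ih =>
      calc r ^ M = r ^ (j + M) * b ^ j := by rw [add_comm]; exact ih
        _ = r ^ j * (r ^ (M + 1) * b) * b ^ j := by rw [pow_add, ← h]
        _ = r ^ (M + (j + 1)) * b ^ (j + 1) := by
          rw [pow_succ' b, ← mul_assoc, ← mul_assoc, ← pow_add]
          congr 3
          omega
  refine ⟨⟨M, hM, fun m hm => ?_⟩, ⟨M, hM, fun m hm => ?_⟩⟩
  · obtain ⟨j, rfl⟩ := Nat.exists_eq_add_of_le hm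
    apply Set.Subset.antisymm
    · rintro _ ⟨x, rfl⟩
      exact ⟨r ^ j * x, by simp only [pow_add, mul_assoc]⟩
    · rintro _ ⟨x, rfl⟩
      exact ⟨b ^ j * x, by simp only [← mul_assoc, ← key j]⟩
  · obtain ⟨j, rfl⟩ := Nat.exists_eq_add_of_le hm
    have key' : r ^ M = b ^ j * r ^ (M + j) := (key j).trans (hb.pow_pow _ _).eq
    apply Set.Subset.antisymm
    · rintro _ ⟨x, rfl⟩
      exact ⟨x * r ^ j, by simp only [add_comm M j, pow_add, mul_assoc]⟩
    · rintro _ ⟨x, rfl⟩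
      exact ⟨x * b ^ j, by simp only [mul_assoc, ← key' ]⟩

/-- A strongly π-regular element admits a Fitting idempotent `f`. -/
theorem IsStronglyPiRegular.exists_idempotent {r : S} (hr : IsStronglyPiRegular r) :
    ∃ f g : S, f * f = f ∧ Commute r f ∧ r * f * g = f ∧ f * g = g ∧
      IsNilpotent (r * (1 - f)) := by
  obtain ⟨⟨k₁, hk₁, h₁⟩, ⟨k₂, hk₂, h₂⟩⟩ := hr
  obtain ⟨k, hk⟩ : ∃ k, k = max k₁ k₂ := ⟨_, rfl⟩
  have hx : r ^ k ∈ Set.range (fun x : S => r ^ (k + k) * x) := by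
    rw [h₁ (k + k) (by omega), ← h₁ k (by omega)]
    exact ⟨1, mul_one _⟩
  have hy : r ^ k ∈ Set.range (fun x : S => x * r ^ (k + k)) := by
    rw [h₂ (k + k) (by omega), ← h₂ k (by omega)]
    exact ⟨1, one_mul _⟩
  obtain ⟨x, hx⟩ := hx
  obtain ⟨y, hy⟩ := hy
  obtain ⟨a, ha⟩ : ∃ a, a = r ^ k := ⟨_, rfl⟩
  simp only [pow_add, ← ha] at hx hy
  have hra : r * a = a * r := by rw [ha, ← pow_succ, ← pow_succ']
  -- With `a = a²x = ya²`, the element `ax = ya` is the Fitting idempotent.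
  have hxy : a * x = y * a := by
    calc a * x = y * (a * a) * x := by rw [hy]
      _ = y * (a * a * x) := by simp only [mul_assoc]
      _ = y * a := by rw [hx]
  have hfa : a * x * a = a := by rw [hxy, mul_assoc, hy]
  have haf : a * (a * x) = a := by rw [← mul_assoc, hx]
  have hff : a * x * (a * x) = a * x := by rw [← mul_assoc, hfa]
  -- For `f = ax`, both `rf` and `fr` equal `frf`: the first by `fa = a`, the second by `af = a` and
  -- `f = ya`.
  have hfr : r * (a * x) = a * x * r * (a * x) := by
    calc r * (a * x) = a * r * x := by rw [← mul_assoc, hra]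
      _ = a * x * a * r * x := by rw [hfa]
      _ = a * x * (a * r) * x := by simp only [mul_assoc]
      _ = a * x * r * (a * x) := by rw [← hra]; simp only [mul_assoc]
  have hrf : a * x * r = a * x * r * (a * x) := by
    calc a * x * r = y * (a * r) := by rw [hxy, mul_assoc]
      _ = y * r * (a * (a * x)) := by rw [← hra, haf, mul_assoc]
      _ = y * (r * a) * (a * x) := by simp only [mul_assoc]
      _ = y * a * r * (a * x) := by rw [hra]; simp only [mul_assoc]
      _ = a * x * r * (a * x) := by rw [← hxy]
  have hc : Commute r (a * x) := hfr.trans hrf.symm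
  have hka : r * r ^ (k - 1) = a := by
    rw [ha, ← pow_succ']
    congr 1
    omega
  -- Since `r * r ^ (k - 1) * x = ax`, the element `r ^ (k - 1) * x` inverts `r` on the image of
  -- `ax`; the extra factor `ax` cuts it down to that image.
  refine ⟨a * x, a * x * (r ^ (k - 1) * x), hff, hc, ?_, ?_, k, ?_⟩
  · calc r * (a * x) * (a * x * (r ^ (k - 1) * x))
        = r * (a * x * (a * x)) * (r ^ (k - 1) * x) := by simp only [mul_assoc]
      _ = a * x * r * (r ^ (k - 1) * x) := by rw [hff, hc.eq]
      _ = a * x * (r * r ^ (k - 1)) * x := by simp only [mul_assoc]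
      _ = a * x := by rw [hka, hfa]
  · rw [← mul_assoc, hff]
  · have hi : IsIdempotentElem (1 - a * x) := IsIdempotentElem.one_sub hff
    rw [((Commute.one_right r).sub_right hc).mul_pow, hi.pow_eq (by omega), ← ha, mul_sub, haf,
      mul_one, sub_self]

end PiRegular

/-! ### Rank idempotents of an idempotent matrix -/

section RankPolynomial

variable {R : Type*} [CommRing R] {n : ℕ}

/-- The determinant of `1 - E + X E`. For an idempotent matrix `E`, its coefficients are the
idempotents cutting out the loci of constant rank of `E`. -/
noncomputable def rankPoly (E : Matrix (Fin n) (Fin n) R) : R[X] :=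
  (1 - C.mapMatrix E + (X : R[X]) • C.mapMatrix E).det

theorem eval₂_rankPoly {S : Type*} [CommRing S] (φ : R →+* S) (s : S)
    (E : Matrix (Fin n) (Fin n) R) :
    (rankPoly E).eval₂ φ s = (1 - φ.mapMatrix E + s • φ.mapMatrix E).det := by
  rw [rankPoly, ← coe_eval₂RingHom, RingHom.map_det]
  congr 1
  ext i j
  by_cases hij : i = j <;> simp [hij, mul_comm s]

theorem eval_one_rankPoly (E : Matrix (Fin n) (Fin n) R) : (rankPoly E).eval 1 = 1 := by
  rw [eval, eval₂_rankPoly]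
  simp

/-- Taking determinants turns this into `d(s) d(t) = d(st)` for the rank polynomial `d`. -/
theorem idempotent_pencil_mul {A : Type*} [Ring A] {S : Type*} [CommRing S] [Algebra S A]
    {F : A} (hF : F * F = F) (s t : S) :
    (1 - F + s • F) * (1 - F + t • F) = 1 - F + (s * t) • F := by
  have h1 : (1 - F) * (1 - F) = 1 - F := IsIdempotentElem.one_sub hF
  have h2 : (1 - F) * F = 0 := by rw [sub_mul, one_mul, hF, sub_self]
  have h3 : F * (1 - F) = 0 := by rw [mul_sub, mul_one, hF, sub_self]
  simp only [add_mul, mul_add, h1, mul_smul_comm, smul_mul_assoc, h2, h3, hF, smul_zero, add_zero,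
    zero_add, smul_smul, mul_comm t s]

/-- Compare coefficients of `t ^ j` in `d(s) d(t) = d(st)` over `R[s][t]`; here `s` is `C X` and `t`
is the outer `X`. -/
theorem rankPoly_mul_C_coeff {E : Matrix (Fin n) (Fin n) R} (hE : E * E = E) (j : ℕ) :
    rankPoly E * C ((rankPoly E).coeff j) = C ((rankPoly E).coeff j) * X ^ j := by
  let ψ : R →+* R[X][X] := C.comp C
  have hψ : ψ.mapMatrix E * ψ.mapMatrix E = ψ.mapMatrix E := by rw [← map_mul, hE]
  have h := congrArg Matrix.det (idempotent_pencil_mul hψ (C X : R[X][X]) X)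
  rw [Matrix.det_mul, ← eval₂_rankPoly, ← eval₂_rankPoly, ← eval₂_rankPoly] at h
  have e1 : (rankPoly E).eval₂ ψ (C X) = C (rankPoly E) := by
    rw [← hom_eval₂, eval₂_C_X]
  have e2 : (rankPoly E).eval₂ ψ X = (rankPoly E).map C := by
    rw [eval₂_eq_sum_range, map, eval₂_eq_sum_range]
  have e3 : (rankPoly E).eval₂ ψ (C X * X)
      = (rankPoly E).sum fun i a => monomial i (C a * X ^ i) := by
    rw [eval₂_eq_sum]
    refine Finset.sum_congr rfl fun i _ => ?_
    beta_reduce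
    rw [mul_pow, ← C_pow, ← mul_assoc, RingHom.comp_apply, ← C_mul, C_mul_X_pow_eq_monomial]
  rw [e1, e2, e3] at h
  have hj := congrArg (fun q => coeff q j) h
  simp only [coeff_C_mul, coeff_map] at hj
  rw [hj, sum_def, finsetSum_coeff]
  simp only [coeff_monomial]
  rw [Finset.sum_ite_eq']
  split_ifs with hjs
  · rfl
  · simp [notMem_support_iff.mp hjs]

/-- Orthogonality is read off coefficientwise from `d * dⱼ = dⱼ * X ^ j`, and completeness is `d(1)
= 1`. -/
theorem completeOrthogonalIdempotents_coeff_rankPoly {E : Matrix (Fin n) (Fin n) R}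
    (hE : E * E = E) :
    CompleteOrthogonalIdempotents
      fun i : Fin ((rankPoly E).natDegree + 1) => (rankPoly E).coeff i := by
  rw [CompleteOrthogonalIdempotents.iff_ortho_complete]
  constructor
  · intro i j hij
    have h := congrArg (fun q => coeff q (i : ℕ)) (rankPoly_mul_C_coeff hE (j : ℕ))
    simp only [coeff_mul_C, coeff_C_mul, coeff_X_pow] at h
    rw [if_neg (fun h' => hij (Fin.ext h')), mul_zero] at h
    exact h
  · have h := eval_one_rankPoly E
    rw [eval_eq_sum_range, Finset.sum_range] at h
    simpa using h

end RankPolynomial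

/-! ### Corner rings and divisibility from factorizations -/

section Corner

variable {R : Type*} [CommRing R] {e : R}

theorem coe_cornerMap (he : IsIdempotentElem e) (r : R) :
    (cornerMap he r).1 = e * r := by
  change e * r * e = e * r
  rw [mul_right_comm, he.eq]

theorem cornerMap_self (he : IsIdempotentElem e) : cornerMap he e = 1 := by
  apply Subtype.ext
  rw [coe_cornerMap]
  exact he.eq

theorem cornerMap_surjective (he : IsIdempotentElem e) : Function.Surjective (cornerMap he) := by
  rintro ⟨_, r, rfl⟩
  exact ⟨r, rfl⟩

theorem C_mul_eq_of_map_cornerMap_eq (he : IsIdempotentElem e) {p q : R[X]}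
    (h : p.map (cornerMap he) = q.map (cornerMap he)) : C e * p = C e * q := by
  ext i
  have hi := congrArg (fun q => (coeff q i).1) h
  simpa only [coeff_map, coe_cornerMap, coeff_C_mul] using hi

end Corner

/-- A polynomial with an SP-factorization divides some `X ^ M * (1 - X * q)`. -/
theorem HasSPFactorization.exists_dvd {S : Type*} [CommRing S] {h : S[X]}
    (hh : HasSPFactorization h) : ∃ (M : ℕ) (q : S[X]), h ∣ X ^ M * (1 - X * q) := by
  obtain ⟨h₀, p, rfl, hu, hp⟩ := hh
  have hnil : IsNilpotent (X ^ p.natDegree - p) := by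
    rw [← neg_sub, isNilpotent_neg_iff, Polynomial.isNilpotent_iff]
    exact hp
  obtain ⟨k, hk⟩ := hnil
  have hdvd : p ∣ X ^ (p.natDegree * k) := by
    have h1 := sub_dvd_pow_sub_pow (X ^ p.natDegree) (X ^ p.natDegree - p) k
    rwa [sub_sub_cancel, hk, sub_zero, ← pow_mul] at h1
  obtain ⟨u, hu⟩ := hu
  -- Writing `h₀ = u + X * divX h₀` gives `u⁻¹ h₀ = 1 - X * q` for this `q`.
  refine ⟨p.natDegree * k, -(C (↑u⁻¹ : S) * h₀.divX), ?_⟩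
  rw [mul_comm h₀]
  refine mul_dvd_mul hdvd ⟨C (↑u⁻¹ : S), ?_⟩
  have h0 : h₀.coeff 0 = u := by rw [hu, coeff_zero_eq_eval_zero]
  have huu : (C (u : S) : S[X]) * C (↑u⁻¹ : S) = 1 := by rw [← C_mul, u.mul_inv, C_1]
  have hd := divX_mul_X_add h₀
  rw [h0] at hd
  linear_combination (C (↑u⁻¹ : S)) * hd - huu

/-- A polynomial with a gSP-factorization divides some `X ^ M * (1 - X * q)`. -/
theorem HasGSPFactorization.exists_dvd {R : Type*} [CommRing R] {h : R[X]}
    (hh : HasGSPFactorization h) : ∃ (M : ℕ) (q : R[X]), h ∣ X ^ M * (1 - X * q) := by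
  obtain ⟨k, e, he, hsp⟩ := hh
  have key : ∀ i, ∃ (M : ℕ) (q w : R[X]), C (e i) * (X ^ M * (1 - X * q)) = C (e i) * (h * w) := by
    intro i
    obtain ⟨M, q, w, hw⟩ := (hsp i).exists_dvd
    obtain ⟨q, rfl⟩ := map_surjective _ (cornerMap_surjective (he.idem i)) q
    obtain ⟨w, rfl⟩ := map_surjective _ (cornerMap_surjective (he.idem i)) w
    refine ⟨M, q, w, C_mul_eq_of_map_cornerMap_eq (he.idem i) ?_⟩
    rw [Polynomial.map_mul, Polynomial.map_mul, ← hw]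
    simp
  choose M q w hw using key
  have hsum : ∑ i, (C (e i) : R[X]) = 1 := by rw [← map_sum, he.complete, C_1]
  -- The sum of the `M i` serves as a common exponent; each component is padded by the missing power
  -- of `X`.
  refine ⟨∑ i, M i, ∑ i, C (e i) * q i, ∑ i, C (e i) * (X ^ (∑ j, M j - M i) * w i), ?_⟩
  calc (X : R[X]) ^ (∑ i, M i) * (1 - X * ∑ i, C (e i) * q i)
      = ∑ i, X ^ (∑ i, M i) * (C (e i) - X * (C (e i) * q i)) := by
        rw [← Finset.mul_sum, Finset.sum_sub_distrib, hsum, ← Finset.mul_sum]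
    _ = ∑ i, h * (C (e i) * (X ^ (∑ j, M j - M i) * w i)) := by
        refine Finset.sum_congr rfl fun i _ => ?_
        have hM : (X : R[X]) ^ (∑ j, M j) = X ^ (∑ j, M j - M i) * X ^ M i := by
          rw [← pow_add, Nat.sub_add_cancel
            (Finset.single_le_sum (fun _ _ => Nat.zero_le _) (Finset.mem_univ i))]
        rw [hM]
        linear_combination X ^ (∑ j, M j - M i) * hw i
    _ = _ := by rw [Finset.mul_sum]

/-! ### Characteristic polynomials -/

section Charpoly

variable {R : Type*} [CommRing R] {n : ℕ}

theorem isStronglyPiRegular_of_charpoly_dvd {A : Matrix (Fin n) (Fin n) R} {M : ℕ} {q : R[X]}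
    (h : A.charpoly ∣ X ^ M * (1 - X * q)) : IsStronglyPiRegular A := by
  obtain ⟨w, hw⟩ := h
  -- The extra factor `X` makes the exponent positive even when `M = 0`.
  have h0 := congrArg (fun p => aeval A (X * p)) hw
  simp only [map_mul, map_sub, map_one, map_pow, aeval_X, Matrix.aeval_self_charpoly, zero_mul,
    mul_zero] at h0
  refine IsStronglyPiRegular.of_pow_eq (M := M + 1) (b := aeval A q) (by omega) ?_ ?_
  · have := (Commute.all (X : R[X]) q).map (aeval A)
    rwa [aeval_X] at this
  · rw [← mul_assoc, ← pow_succ', mul_sub, mul_one, ← mul_assoc, ← pow_succ] at h0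
    exact sub_eq_zero.mp h0

/-- For multiplication by the root of `h` in `R[X]/(h)`, Cayley–Hamilton makes `h` divide the
characteristic polynomial; both are monic of degree `n`. -/
theorem exists_matrix_charpoly_eq {h : R[X]} (hmonic : h.Monic) (hdeg : h.natDegree = n) :
    ∃ A : Matrix (Fin n) (Fin n) R, A.charpoly = h := by
  nontriviality R
  have hdim : (AdjoinRoot.powerBasis' hmonic).dim = n := by
    rw [AdjoinRoot.powerBasis'_dim, hdeg]
  obtain ⟨b, hb⟩ : ∃ b, b = AdjoinRoot.powerBasis' hmonic := ⟨_, rfl⟩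
  rw [← hb] at hdim
  have hgen : b.gen = AdjoinRoot.root h := by rw [hb, AdjoinRoot.powerBasis'_gen]
  subst hdim
  refine ⟨Algebra.leftMulMatrix b.basis b.gen, ?_⟩
  have h0 : aeval b.gen (Algebra.leftMulMatrix b.basis b.gen).charpoly = 0 := by
    apply Algebra.leftMulMatrix_injective b.basis
    rw [← aeval_algHom_apply, Matrix.aeval_self_charpoly, map_zero]
  rw [hgen, AdjoinRoot.aeval_eq, AdjoinRoot.mk_eq_zero, ← hgen] at h0
  refine eq_of_monic_of_dvd_of_natDegree_le hmonic (Matrix.charpoly_monic _) h0 ?_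
  rw [Matrix.charpoly_natDegree_eq_dim, Fintype.card_fin, hdeg]

/-- The factorization of `B` into its parts on the image and on the kernel of an idempotent `F`
commuting with it. -/
theorem fitting_factorization {A : Type*} [Ring A] {B F : A} (hB : Commute B F) (hF : F * F = F) :
    (B * F + (1 - F)) * (B * (1 - F) + F) = B := by
  have h1 : (1 - F) * F = 0 := by rw [sub_mul, one_mul, hF, sub_self]
  have h2 : F * (1 - F) = 0 := by rw [mul_sub, mul_one, hF, sub_self]
  have h3 : (1 - F) * (1 - F) = 1 - F := IsIdempotentElem.one_sub hF
  have h4 : (1 - F) * B = B * (1 - F) := by rw [sub_mul, mul_sub, hB.eq, one_mul, mul_one]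
  calc (B * F + (1 - F)) * (B * (1 - F) + F)
      = B * (F * B) * (1 - F) + B * (F * F) + (1 - F) * B * (1 - F) + (1 - F) * F := by
        noncomm_ring
    _ = B * B * (F * (1 - F)) + B * F + B * ((1 - F) * (1 - F)) := by
        rw [← hB.eq, hF, h4, h1]
        simp only [mul_assoc, add_zero]
    _ = B := by rw [h2, h3]; noncomm_ring

/-- A factorization `h₀ * p` with `h₀(0)` a unit and `X ^ n * p = χ * d`, where `χ` is the
characteristic polynomial of a nilpotent matrix, becomes an SP-factorization wherever `d` becomes
a power of `X`. -/
theorem hasSPFactorization_map_mul {S : Type*} [CommRing S] (φ : R →+* S) {h₀ p d : R[X]} {i : ℕ}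
    {N : Matrix (Fin n) (Fin n) R} (hN : IsNilpotent N) (hu : IsUnit (h₀.eval 0))
    (hXp : X ^ n * p = N.charpoly * d) (hd : d.map φ = X ^ i) :
    HasSPFactorization ((h₀ * p).map φ) := by
  refine ⟨h₀.map φ, p.map φ, Polynomial.map_mul _, ?_, fun k => ?_⟩
  · rw [eval_zero_map]
    exact hu.map φ
  rw [mem_nilradical]
  nontriviality S
  have := φ.domain_nontrivial
  have hχ := N.charpoly_monic
  have hnil := Matrix.isNilpotent_charpoly_sub_pow_of_isNilpotent hN
  rw [Fintype.card_fin] at hnil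
  have hXφ : X ^ n * p.map φ = N.charpoly.map φ * X ^ i := by
    have h := congrArg (Polynomial.map φ) hXp
    simpa only [Polynomial.map_mul, hd, Polynomial.map_pow, map_X] using h
  -- `χ` is `X ^ n` up to nilpotents. The factor `X ^ n` only shifts coefficients, so it does no
  -- harm.
  have hnilφ : IsNilpotent ((p.map φ - X ^ i) * X ^ n) := by
    have h1 := (Commute.all _ (X ^ i)).isNilpotent_mul_right (hnil.map (mapRingHom φ))
    have h2 : mapRingHom φ (N.charpoly - X ^ n) * X ^ i = (p.map φ - X ^ i) * X ^ n := by
      rw [coe_mapRingHom, Polynomial.map_sub, Polynomial.map_pow, map_X]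
      linear_combination -hXφ
    rwa [h2] at h1
  -- Monicity lets degrees be compared in `hXφ`, identifying the exponent `natDegree` with `i`.
  have hpm : (p.map φ).Monic := by
    refine Monic.of_mul_monic_left (monic_X_pow n) ?_
    rw [hXφ]
    exact (hχ.map φ).mul (monic_X_pow _)
  have hpdeg : (p.map φ).natDegree = i := by
    have h := congrArg natDegree hXφ
    rw [(monic_X_pow n).natDegree_mul hpm, (hχ.map φ).natDegree_mul (monic_X_pow _),
      natDegree_X_pow, natDegree_X_pow, hχ.natDegree_map, Matrix.charpoly_natDegree_eq_dim,
      Fintype.card_fin] at h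
    omega
  rw [hpdeg, ← coeff_mul_X_pow _ n]
  exact Polynomial.isNilpotent_iff.mp hnilφ _

theorem hasGSPFactorization_charpoly {A : Matrix (Fin n) (Fin n) R}
    (hA : IsStronglyPiRegular A) : HasGSPFactorization A.charpoly := by
  obtain ⟨f, g, hff, hc, hfg, hg, hnil⟩ := hA.exists_idempotent
  have hE : (1 - f) * (1 - f) = 1 - f := IsIdempotentElem.one_sub hff
  have hfE : f * (1 - f) = 0 := by rw [mul_sub, mul_one, hff, sub_self]
  have hEf : (1 - f) * f = 0 := by rw [sub_mul, one_mul, hff, sub_self]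
  let Φ : Matrix (Fin n) (Fin n) R →+* Matrix (Fin n) (Fin n) R[X] := C.mapMatrix
  have hcharm : ∀ N : Matrix (Fin n) (Fin n) R,
      N.charpoly = ((X : R[X]) • (1 : Matrix (Fin n) (Fin n) R[X]) - Φ N).det := by
    intro N
    rw [Matrix.charpoly, Matrix.charmatrix, Matrix.smul_one_eq_diagonal, Matrix.scalar_apply]
  let N := A * (1 - f)
  let h₀ : R[X] := (((X : R[X]) • (1 : Matrix (Fin n) (Fin n) R[X]) - Φ A) * Φ f + Φ (1 - f)).det
  let p : R[X] := ((X : R[X]) • Φ (1 - f) - Φ N + Φ f).det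
  have hfac : A.charpoly = h₀ * p := by
    rw [hcharm, ← Matrix.det_mul]
    congr 1
    refine Eq.trans (fitting_factorization (F := Φ f) ?_ (by rw [← map_mul, hff])).symm ?_
    · exact ((Commute.one_left _).smul_left _).sub_left (hc.map Φ)
    · simp only [N, map_sub, map_mul, map_one, sub_mul, smul_mul_assoc, one_mul]
  -- Determinants of `X (X (1 - f) - N + f) = (X - N) (f + X (1 - f))`, which holds because `N f =
  -- 0` and `N (1 - f) = N`.
  have hXp : X ^ n * p = N.charpoly * rankPoly (1 - f) := by
    have hNf : Φ N * Φ f = 0 := by rw [← map_mul, mul_assoc, hEf, mul_zero, map_zero]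
    have hNE : Φ N * Φ (1 - f) = Φ N := by rw [← map_mul, mul_assoc, hE]
    have hX : (X : R[X]) ^ n = ((X : R[X]) • (1 : Matrix (Fin n) (Fin n) R[X])).det := by
      rw [Matrix.det_smul, Matrix.det_one, mul_one, Fintype.card_fin]
    have hrank : rankPoly (1 - f) = (Φ f + (X : R[X]) • Φ (1 - f)).det := by
      rw [rankPoly]
      change (1 - Φ (1 - f) + (X : R[X]) • Φ (1 - f)).det = _
      rw [map_sub Φ, map_one, sub_sub_cancel]
    rw [hcharm, hX, hrank, ← Matrix.det_mul, ← Matrix.det_mul]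
    congr 1
    simp only [sub_mul, mul_add, smul_mul_assoc, one_mul, mul_smul_comm, hNf, hNE, smul_sub]
    abel
  have hu : IsUnit (h₀.eval 0) := by
    have h0 : h₀.eval 0 = (-(A * f) + (1 - f)).det := by
      rw [← coe_evalRingHom, RingHom.map_det]
      congr 1
      ext i j
      have hone : ∀ a b : Fin n, eval 0 ((1 : Matrix (Fin n) (Fin n) R[X]) a b)
          = (1 : Matrix (Fin n) (Fin n) R) a b := by
        intro a b
        rw [Matrix.one_apply, Matrix.one_apply]
        split_ifs <;> simp
      simp [Φ, Matrix.mul_apply, eval_finsetSum, hone]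
    rw [h0]
    -- On the image of `f` the matrix is `-A`, with inverse `-g`; on the kernel it is the identity.
    refine IsUnit.of_mul_eq_one (-g + (1 - f)).det ?_
    have hEg : (1 - f) * g = 0 := by rw [sub_mul, one_mul, hg, sub_self]
    rw [← Matrix.det_mul, add_mul, mul_add, mul_add, neg_mul_neg, hfg, hE, mul_neg, hEg, neg_mul,
      mul_assoc, hfE, mul_zero, neg_zero, add_zero, zero_add, add_sub_cancel, Matrix.det_one]
  suffices key : ∀ (i : ℕ) (c : R) (he : IsIdempotentElem c), (rankPoly (1 - f)).coeff i = c →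
      HasSPFactorization (A.charpoly.map (cornerMap he)) from
    ⟨_, _, completeOrthogonalIdempotents_coeff_rankPoly hE, fun i => key i _ _ rfl⟩
  intro i c he hci
  have hd : (rankPoly (1 - f)).map (cornerMap he) = X ^ i := by
    have h := congrArg (Polynomial.map (cornerMap he)) (rankPoly_mul_C_coeff hE i)
    simpa only [hci, Polynomial.map_mul, map_C, cornerMap_self, C_1, mul_one, one_mul,
      Polynomial.map_pow, map_X] using h
  rw [hfac]
  exact hasSPFactorization_map_mul _ hnil hu hXp hd

end Charpoly

end CleanMatrix

theorem mainTheorem4 {R : Type*} [CommRing R] (hR : CleanMatrix.IsCleanRing R)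
    (n : ℕ) (h : R[X]) (hmonic : h.Monic) (hdeg : h.natDegree = n) :
    List.TFAE [
      ∀ A : Matrix (Fin n) (Fin n) R, A.charpoly = h → CleanMatrix.IsStronglyPiRegular A,
      ∃ A : Matrix (Fin n) (Fin n) R, A.charpoly = h ∧ CleanMatrix.IsStronglyPiRegular A,
      CleanMatrix.HasGSPFactorization h] := by
  tfae_have 1 → 2 := by
    intro H
    obtain ⟨A, hA⟩ := CleanMatrix.exists_matrix_charpoly_eq hmonic hdeg
    exact ⟨A, hA, H A hA⟩
  tfae_have 2 → 3 := by
    rintro ⟨A, rfl, hA⟩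
    exact CleanMatrix.hasGSPFactorization_charpoly hA
  tfae_have 3 → 1 := by
    rintro H A rfl
    obtain ⟨M, q, hq⟩ := H.exists_dvd
    exact CleanMatrix.isStronglyPiRegular_of_charpoly_dvd hq
  tfae_finish
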